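/- Call a topological space $Y$ *homogeneous* if for all $x,y\in Y$ there is a homeomorphism $h:Y\to Y$ with $h(x)=y$, and call a space $X$ *power homogeneous* if there is a cardinal $\kappa\ge 1$ such that the power $X^\kappa$, with the product topology, is homogeneous. A space $X$ has *countable $\pi$-character* if every $x\in X$ has a countable local $\pi$-base, that is, a countable family $\mathcal B$ of non-empty open subsets of $X$ such that every neighborhood of $x$ includes a member of $\mathcal B$. A space $Y$ is *countably tight* if whenever $A\subseteq Y$ and $x\in\overline{A}$, there is a countable $B\subseteq A$ with $x\in\overline{B}$. **Corollary 3.9.** Let $X$ be a power homogeneous compact Hausdorff space of countable $\pi$-character. Suppose that $X$ has a cover $\mathcal C$ with $|\mathcal C|\le\mathfrak c$ such that every $C\in\mathcal C$ is dense in $X$ and is countably tight in the subspace topology. Then $|X|\le\mathfrak c$, where $\mathfrak c=2^{\aleph_0}$. -/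

import Mathlib

open Cardinal Topology

universe u v

/-- A space is homogeneous if any point can be moved to any other point by a homeomorphism of the
space onto itself. -/
def IsHomogeneousSpace (X : Type u) [TopologicalSpace X] : Prop :=
  ∀ x y : X, ∃ h : X ≃ₜ X, h x = y

/-- A space `X` is power homogeneous if some power `X ^ κ` with `κ ≥ 1`, in the product topology, is
homogeneous. The index set of the power may live in any universe `v`. (The exponent `0` has to be
excluded, since `X ^ 0` is a one-point space for every `X`.) -/
def IsPowerHomogeneous (X : Type u) [TopologicalSpace X] : Prop :=
  ∃ ι : Type v, Nonempty ι ∧ IsHomogeneousSpace (ι → X)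

/-- `B` is a local π-base at `x`: a family of nonempty open sets (not required to contain `x`) such
that every neighborhood of `x` includes a member of `B`. -/
def IsLocalPiBase {X : Type u} [TopologicalSpace X] (x : X) (B : Set (Set X)) : Prop :=
  (∀ U ∈ B, IsOpen U ∧ U.Nonempty) ∧ ∀ V ∈ 𝓝 x, ∃ U ∈ B, U ⊆ V

/-- A space has countable π-character if every point has a countable local π-base. -/
def HasCountablePiCharacter (X : Type u) [TopologicalSpace X] : Prop :=
  ∀ x : X, ∃ B : Set (Set X), B.Countable ∧ IsLocalPiBase x B

/-- A space is countably tight if every point in the closure of a set `A` is in the closure of a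
countable subset of `A`. -/
def IsCountablyTight (X : Type u) [TopologicalSpace X] : Prop :=
  ∀ (A : Set X) (x : X), x ∈ closure A → ∃ B ⊆ A, B.Countable ∧ x ∈ closure B

/-! Picking, for each point and each member of the cover, points of that member in a countable
π-base gives families `E` that detect closures: tightness of a member containing a limit leaves only
countably many of them (`exists_tightness_witness`). A transfinite sequence of length `ω₁` then
yields a nonempty closed Gδ set inside the closure of a set of size `𝔠`, hence a Gδ set `H` whose
points `𝔠` open sets separate from all others. Homogeneity of the power spreads this from `H`. A
homeomorphism between constant functions gives an open map to `X` with a section, and countable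
π-character makes it constant on slices fixing countably many coordinates
(`exists_seq_slice_const`). So closures of countable sets are separated by `𝔠` open sets, a
closing-off argument gives a dense set of size `𝔠`, and points are coded by sequences in it. -/

/-! ### Open maps out of powers and countable sets of coordinates. -/

theorem exists_seq_localPiBase {X : Type u} [TopologicalSpace X]
    (hpi : HasCountablePiCharacter X) (x : X) :
    ∃ U : ℕ → Set X, (∀ n, IsOpen (U n) ∧ (U n).Nonempty) ∧ ∀ V ∈ 𝓝 x, ∃ n, U n ⊆ V := by
  obtain ⟨B, hB, hB1, hB2⟩ := hpi x
  have hne : B.Nonempty := by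
    obtain ⟨U, hU, -⟩ := hB2 Set.univ Filter.univ_mem
    exact ⟨U, hU⟩
  obtain ⟨U, rfl⟩ := hB.exists_eq_range hne
  exact ⟨U, fun n => hB1 _ ⟨n, rfl⟩, fun V hV => by
    obtain ⟨_, ⟨n, rfl⟩, h⟩ := hB2 V hV
    exact ⟨n, h⟩⟩

/-- Membership in an open subset of a product is decided by finitely many coordinates. -/
theorem exists_finset_box {ι : Type v} {X : Type u} [TopologicalSpace X] {O : Set (ι → X)}
    (hO : IsOpen O) {w : ι → X} (hw : w ∈ O) :
    ∃ (I : Finset ι) (t : ι → Set X), (∀ i, IsOpen (t i) ∧ w i ∈ t i) ∧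
      ∀ z : ι → X, (∀ i ∈ I, z i ∈ t i) → z ∈ O := by
  classical
  obtain ⟨I, u, hu, hsub⟩ := isOpen_pi_iff.1 hO w hw
  refine ⟨I, fun i => if i ∈ I then u i else Set.univ, fun i => ?_, fun z hz => hsub ?_⟩
  · by_cases hi : i ∈ I
    · simpa [hi] using hu i hi
    · simp [hi]
  · intro i hi
    have := hz i hi
    simpa [Finset.mem_coe.1 hi] using this

/-- Closing off under a map from finite subsets to finite subsets keeps countability. -/
theorem exists_countable_closed {α : Type*} {β : Type*} [Countable β]
    (S : Finset (α × β) → ℕ → Finset α) :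
    ∃ B : Set α, B.Countable ∧ ∀ c : Finset (α × β), (∀ x ∈ c, x.1 ∈ B) → ∀ n, ↑(S c n) ⊆ B := by
  classical
  let G : Set α → Set α := fun B =>
    B ∪ ⋃ c ∈ {c : Finset (α × β) | ∀ x ∈ c, x.1 ∈ B}, ⋃ n, (S c n : Set α)
  have hG : ∀ B : Set α, B.Countable → (G B).Countable := by
    intro B hB
    refine hB.union (Set.Countable.biUnion ?_ fun c _ =>
      Set.countable_iUnion fun n => (S c n).countable_toSet)
    have h1 : (B ×ˢ (Set.univ : Set β)).Countable := hB.prod Set.countable_univ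
    have h2 := Set.countable_ofPred_finite_subset h1
    have h3 : ((fun c : Finset (α × β) => (c : Set (α × β))) ''
        {c : Finset (α × β) | ∀ x ∈ c, x.1 ∈ B}).Countable := by
      refine h2.mono ?_
      rintro _ ⟨c, hc, rfl⟩
      exact ⟨c.finite_toSet, fun x hx => ⟨hc x hx, trivial⟩⟩
    exact Set.countable_of_injective_of_countable_image Finset.coe_injective.injOn h3
  let s : ℕ → Set α := fun n => G^[n] ∅
  have hs : ∀ n, s (n + 1) = G (s n) := fun n => Function.iterate_succ_apply' G n ∅
  have hmono : Monotone s := monotone_nat_of_le_succ fun n => by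
    rw [hs]; exact Set.subset_union_left
  refine ⟨⋃ n, s n, Set.countable_iUnion fun n => ?_, fun c hc n => ?_⟩
  · induction n with
    | zero => exact Set.countable_empty
    | succ k ih => rw [hs]; exact hG _ ih
  · have : ∃ m, ∀ x ∈ c, x.1 ∈ s m := by
      have h : ∀ x : α × β, ∃ k, x ∈ c → x.1 ∈ s k := fun x => by
        by_cases hx : x ∈ c
        · obtain ⟨k, hk⟩ := Set.mem_iUnion.1 (hc x hx)
          exact ⟨k, fun _ => hk⟩
        · exact ⟨0, fun h => absurd h hx⟩
      choose k hk using h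
      exact ⟨c.sup k, fun x hx => hmono (Finset.le_sup hx) (hk x hx)⟩
    obtain ⟨m, hm⟩ := this
    refine Set.Subset.trans ?_ (Set.subset_iUnion s (m + 1))
    rw [hs]
    refine Set.Subset.trans ?_ Set.subset_union_right
    exact Set.Subset.trans (Set.subset_iUnion (fun n => (S c n : Set α)) n)
      (Set.subset_biUnion_of_mem (u := fun c => ⋃ n, (S c n : Set α)) hm)

/-- A continuous open map out of a power of a Hausdorff space of countable π-character is constant
on some slice through any given point that fixes only countably many coordinates. -/
theorem exists_seq_slice_const {X : Type u} [TopologicalSpace X] [T2Space X]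
    (hpi : HasCountablePiCharacter X) {ι : Type v} [Nonempty ι] (f : (ι → X) → X)
    (hf : Continuous f) (hfo : IsOpenMap f) (w : ι → X) :
    ∃ e : ℕ → ι, ∀ z : ι → X, (∀ n, z (e n) = w (e n)) → f z = f w := by
  classical
  choose U hU hUsub using fun i => exists_seq_localPiBase hpi (w i)
  choose G hG hGsub using fun x : X => exists_seq_localPiBase hpi x
  let P : Finset (ι × ℕ) → Set (ι → X) := fun c => {z | ∀ x ∈ c, z x.1 ∈ U x.1 x.2}
  have hP : ∀ c, IsOpen (P c) := fun c => by
    have : P c = ⋂ x ∈ c, (fun z : ι → X => z x.1) ⁻¹' U x.1 x.2 := by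
      ext z; simp [P]
    rw [this]
    exact isOpen_biInter_finset fun x _ => (hU x.1 x.2).1.preimage (continuous_apply x.1)
  have hq : ∀ c : Finset (ι × ℕ), ∃ q : ι → X, (∃ z ∈ P c, ∀ i, (∀ m, (i, m) ∉ c) → z i = w i) →
      q ∈ P c ∧ ∀ i, (∀ m, (i, m) ∉ c) → q i = w i := fun c => by
    by_cases h : ∃ z ∈ P c, ∀ i, (∀ m, (i, m) ∉ c) → z i = w i
    · obtain ⟨z, hz⟩ := h
      exact ⟨z, fun _ => hz⟩
    · exact ⟨w, fun h' => absurd h' h⟩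
  choose q hq using hq
  have hS : ∀ (c : Finset (ι × ℕ)) (n : ℕ), ∃ (v : ι → X) (S : Finset ι),
      (f ⁻¹' G (f (q c)) n ∩ P c).Nonempty →
      ∀ z : ι → X, (∀ i ∈ S, z i = v i) → z ∈ f ⁻¹' G (f (q c)) n ∩ P c := fun c n => by
    by_cases h : (f ⁻¹' G (f (q c)) n ∩ P c).Nonempty
    · obtain ⟨v, hv⟩ := h
      obtain ⟨I, t, ht, hI⟩ := exists_finset_box (((hG _ n).1.preimage hf).inter (hP c)) hv
      exact ⟨v, I, fun _ z hz => hI z fun i hi => by rw [hz i hi]; exact (ht i).2⟩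
    · exact ⟨w, ∅, fun h' => absurd h' h⟩
  choose v S hS using hS
  -- `B` acts as a countable elementary submodel: the boxes chosen for data over `B` have their
  -- supports in `B`.
  obtain ⟨B, hB, hBS⟩ := exists_countable_closed S
  obtain ⟨e, he⟩ := (hB.insert (Classical.arbitrary ι)).exists_eq_range (Set.insert_nonempty _ _)
  refine ⟨e, fun z hz => ?_⟩
  have hzB : ∀ i ∈ B, z i = w i := fun i hi => by
    have : i ∈ Set.range e := he ▸ Set.mem_insert_of_mem _ hi
    obtain ⟨n, rfl⟩ := this
    exact hz n
  by_contra hne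
  obtain ⟨O2, O1, hO2, hO1, hz2, hw1, hdisj⟩ := t2_separation hne
  obtain ⟨I', t', ht', hI'⟩ := exists_finset_box (hO1.preimage hf) (w := w) hw1
  obtain ⟨I, t, ht, hI⟩ := exists_finset_box (hO2.preimage hf) (w := z) hz2
  have hm : ∀ i, ∃ m, i ∈ B → U i m ⊆ t i ∩ t' i := fun i => by
    by_cases hi : i ∈ B
    · obtain ⟨m, hm⟩ := hUsub i (t i ∩ t' i) (((ht i).1.inter (ht' i).1).mem_nhds
        ⟨hzB i hi ▸ (ht i).2, (ht' i).2⟩)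
      exact ⟨m, fun _ => hm⟩
    · exact ⟨0, fun h => absurd h hi⟩
  choose m hm using hm
  let E := (I ∪ I').filter (· ∈ B)
  let c : Finset (ι × ℕ) := E.image fun i => (i, m i)
  have hEB : ∀ i ∈ E, i ∈ B := fun i hi => (Finset.mem_filter.1 hi).2
  have hPc : ∀ y ∈ P c, ∀ i ∈ E, y i ∈ t i ∩ t' i := fun y hy i hi =>
    hm i (hEB i hi) (hy _ (Finset.mem_image_of_mem _ hi))
  have hqc := hq c ⟨fun i => if i ∈ E then (hU i (m i)).2.some else w i, by
    intro x hx
    obtain ⟨i, hi, rfl⟩ := Finset.mem_image.1 hx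
    simp only [hi, if_true]
    exact (hU i (m i)).2.some_mem, fun i hi => by
    have : i ∉ E := fun h => hi (m i) (Finset.mem_image_of_mem _ h)
    simp [this]⟩
  -- `R` lies in `f ⁻¹' O1`, and openness of `f` puts some `G (f (q c)) n` inside `f '' R`.
  let R : Set (ι → X) := P c ∩ ⋂ i ∈ I', (fun z : ι → X => z i) ⁻¹' t' i
  have hR : IsOpen R := (hP c).inter
    (isOpen_biInter_finset fun i _ => (ht' i).1.preimage (continuous_apply i))
  have hqR : q c ∈ R := ⟨hqc.1, by
    simp only [Set.mem_iInter, Set.mem_preimage]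
    intro i hi
    by_cases hiB : i ∈ B
    · exact (hPc _ hqc.1 i (Finset.mem_filter.2 ⟨Finset.mem_union_right _ hi, hiB⟩)).2
    · rw [hqc.2 i]
      · exact (ht' i).2
      · intro k hk
        obtain ⟨j, hj, hjk⟩ := Finset.mem_image.1 hk
        have : j = i := congrArg Prod.fst hjk
        exact hiB (this ▸ hEB j hj)⟩
  obtain ⟨n, hn⟩ := hGsub (f (q c)) (f '' R) ((hfo R hR).mem_nhds ⟨_, hqR, rfl⟩)
  have hne' : (f ⁻¹' G (f (q c)) n ∩ P c).Nonempty := by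
    obtain ⟨y, hy⟩ := (hG (f (q c)) n).2
    obtain ⟨r, hr, rfl⟩ := hn hy
    exact ⟨r, hy, hr.1⟩
  have hSB : ∀ i ∈ S c n, i ∈ B := fun i hi => hBS c (fun x hx => by
    obtain ⟨j, hj, rfl⟩ := Finset.mem_image.1 hx
    exact hEB j hj) n hi
  -- The splice is in the preimage of `G (f (q c)) n`, which forces `f z' ∈ O1`; it is also in the
  -- box around `z`, which forces `f z' ∈ O2`.
  let z' : ι → X := fun i => if i ∈ B then v c n i else z i
  have hz' := hS c n hne' z' fun i hi => by simp [z', hSB i hi]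
  have h1 : f z' ∈ O1 := by
    obtain ⟨r, hr, hrz⟩ := hn hz'.1
    rw [← hrz]
    exact hI' r fun i hi => by simpa using Set.mem_iInter₂.1 hr.2 i hi
  have h2 : f z' ∈ O2 := hI z' fun i hi => by
    by_cases hiB : i ∈ B
    · exact (hPc _ hz'.2 i (Finset.mem_filter.2 ⟨Finset.mem_union_left _ hi, hiB⟩)).1
    · simpa [z', hiB] using (ht i).2
  exact Set.disjoint_left.1 hdisj h2 h1

/-! ### Detecting closures. -/

/-- In a space of countable π-character covered by dense countably tight subspaces, every point `s`
and every member of the cover yield a sequence converging to `s` in the weak sense of closures, and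
these sequences detect closures through countable sets. -/
theorem exists_tightness_witness {X : Type u} [TopologicalSpace X]
    (hpi : HasCountablePiCharacter X) (𝒞 : Set (Set X)) (hcover : ⋃₀ 𝒞 = Set.univ)
    (hC : ∀ C ∈ 𝒞, Dense C ∧ IsCountablyTight C) :
    ∃ E : X → 𝒞 → ℕ → X, ∀ (S : Set X) (x : X), x ∈ closure S →
      ∃ (r : 𝒞) (τ : ℕ → X), (∀ n, τ n ∈ S) ∧
        x ∈ closure (Set.range fun p : ℕ × ℕ => E (τ p.1) r p.2) := by
  classical
  choose U hU hUsub using fun x : X => exists_seq_localPiBase hpi x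
  have hE : ∀ (x : X) (C : 𝒞) (n : ℕ), ∃ y, y ∈ U x n ∩ (C : Set X) := fun x C n =>
    (hC C C.2).1.inter_open_nonempty _ (hU x n).1 (hU x n).2
  choose E hE using hE
  refine ⟨E, fun S x hx => ?_⟩
  obtain ⟨C, hC𝒞, hxC⟩ := Set.mem_sUnion.1 (hcover ▸ Set.mem_univ x)
  let r : 𝒞 := ⟨C, hC𝒞⟩
  -- Tightness is only available inside `C`, so `S` is replaced by points of `C` that accumulate at
  -- every point of `S`.
  let A : Set C := {c | ∃ s ∈ S, ∃ k, E s r k = c}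
  have hS : S ⊆ closure ((↑) '' A) := by
    intro s hs
    refine mem_closure_iff_nhds.2 fun V hV => ?_
    obtain ⟨n, hn⟩ := hUsub s V hV
    exact ⟨E s r n, hn (hE s r n).1, ⟨⟨E s r n, (hE s r n).2⟩, ⟨s, hs, n, rfl⟩, rfl⟩⟩
  have hxA : (⟨x, hxC⟩ : C) ∈ closure A :=
    closure_subtype.2 (closure_minimal hS isClosed_closure hx)
  obtain ⟨B, hBA, hBc, hxB⟩ := (hC C hC𝒞).2 A _ hxA
  have hBne : B.Nonempty := closure_nonempty_iff.1 ⟨_, hxB⟩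
  obtain ⟨b, rfl⟩ := hBc.exists_eq_range hBne
  choose τ hτ k hk using fun n => hBA ⟨n, rfl⟩
  refine ⟨r, τ, hτ, ?_⟩
  refine closure_mono ?_ (closure_subtype.1 hxB)
  rintro _ ⟨_, ⟨n, rfl⟩, rfl⟩
  exact ⟨(n, k n), hk n⟩

/-! ### Cardinal bounds and closing off. -/

theorem mk_range_le_continuum {α : Type u} {β : Type v} (f : α → β) (h : #α ≤ 𝔠) :
    #(Set.range f) ≤ 𝔠 := by
  have := mk_range_le_lift (f := f)
  rw [← lift_le_continuum.{v, u}]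
  exact this.trans (lift_le_continuum.2 h)

theorem mk_seq_le_continuum {α : Type u} (h : #α ≤ 𝔠) : #(ℕ → α) ≤ 𝔠 := by
  rw [mk_arrow, lift_uzero, mk_nat, lift_aleph0]
  exact (power_le_power_right h).trans continuum_power_aleph0.le

theorem mk_prod_le_continuum {α : Type u} {β : Type v} (hα : #α ≤ 𝔠) (hβ : #β ≤ 𝔠) :
    #(α × β) ≤ 𝔠 := by
  rw [mk_prod]
  exact (mul_le_mul' (lift_le_continuum.2 hα) (lift_le_continuum.2 hβ)).trans
    continuum_mul_self.le

/-- Closing off a set under an operation from sequences to sets of size at most the continuum. -/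
theorem exists_closed_under {X : Type u} (T : (ℕ → X) → Set X) (hT : ∀ σ, #(T σ) ≤ 𝔠)
    (D₀ : Set X) (hD₀ : #D₀ ≤ 𝔠) :
    ∃ D : Set X, D₀ ⊆ D ∧ #D ≤ 𝔠 ∧ ∀ σ : ℕ → X, (∀ n, σ n ∈ D) → T σ ⊆ D := by
  classical
  have hg : ∀ σ : ℕ → X, ∃ g : Set ℕ → X, T σ ⊆ Set.range g := by
    intro σ
    have h : lift.{0} #(T σ) ≤ lift.{u} #(Set ℕ) := by
      rw [mk_set_nat, lift_continuum, lift_uzero]; exact hT σ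
    obtain ⟨φ⟩ := lift_mk_le'.1 h
    refine ⟨fun s => if h : ∃ y, φ y = s then (h.choose : X) else σ 0, fun y hy => ?_⟩
    have h : ∃ y', φ y' = φ ⟨y, hy⟩ := ⟨_, rfl⟩
    refine ⟨φ ⟨y, hy⟩, ?_⟩
    simp only [h, dif_pos]
    rw [φ.injective h.choose_spec]
  choose g hg using hg
  -- The closure is the set of values of well-founded terms: constants from `D₀`, and one operation
  -- of arity `ℕ` for each `s : Set ℕ`. There are at most `𝔠` such terms.
  let β : D₀ ⊕ Set ℕ → Type := Sum.elim (fun _ => Empty) fun _ => ℕ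
  let ev : (Σ a, β a → X) → X := fun p => match p with
    | ⟨Sum.inl d, _⟩ => d
    | ⟨Sum.inr s, σ⟩ => g σ s
  have hα : #(D₀ ⊕ Set ℕ) ≤ 𝔠 := by
    rw [mk_sum, mk_set_nat, lift_continuum, lift_uzero]
    exact (add_le_add_left hD₀ _).trans continuum_add_self.le
  have hW : #(WType β) ≤ 𝔠 := by
    refine WType.cardinalMk_le_of_le' ?_
    refine (Cardinal.sum_le_sum _ (fun _ => 𝔠) fun a => ?_).trans ?_
    · rcases a with a | a
      · simpa [β] using one_le_aleph0.trans aleph0_le_continuum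
      · simp [β]
    · simpa using mul_le_mul' hα (le_refl 𝔠)
  refine ⟨Set.range (WType.elim X ev), ?_, mk_range_le_continuum _ hW, ?_⟩
  · intro d hd
    exact ⟨WType.mk (Sum.inl ⟨d, hd⟩) Empty.elim, rfl⟩
  · intro σ hσ y hy
    choose w hw using hσ
    obtain ⟨s, hs⟩ := hg σ hy
    refine ⟨WType.mk (Sum.inr s) w, ?_⟩
    rw [← hs]
    change g (fun n => WType.elim X ev (w n)) s = _
    rw [funext hw]

/-- If `D` is closed under the detecting sequences, its closure is the union of the closures of its
countable subsets. -/
theorem exists_seq_of_mem_closure {X : Type u} [TopologicalSpace X] {R : Type*}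
    {E : X → R → ℕ → X} (hE : ∀ (S : Set X) (x : X), x ∈ closure S → ∃ (r : R) (τ : ℕ → X),
      (∀ n, τ n ∈ S) ∧ x ∈ closure (Set.range fun p : ℕ × ℕ => E (τ p.1) r p.2))
    {D : Set X} (hD : ∀ d ∈ D, ∀ r k, E d r k ∈ D) {x : X} (hx : x ∈ closure D) :
    ∃ σ : ℕ → X, (∀ n, σ n ∈ D) ∧ x ∈ closure (Set.range σ) := by
  obtain ⟨r, τ, hτ, hxτ⟩ := hE D x hx
  refine ⟨fun n => E (τ n.unpair.1) r n.unpair.2, fun n => hD _ (hτ _) _ _, closure_mono ?_ hxτ⟩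
  rintro _ ⟨⟨a, b⟩, rfl⟩
  exact ⟨Nat.pair a b, by simp⟩

/-! ### A Gδ set whose points are separated by few open sets. -/

/-- Well-founded recursion with a choice at each step. -/
theorem exists_wellFounded_choice {I : Type*} [LinearOrder I] [WellFoundedLT I] {α : Type*}
    [Nonempty α] (Q : ∀ i : I, (∀ j, j < i → α) → α → Prop)
    (h : ∀ (i : I) (f : I → α), (∀ j < i, Q j (fun k _ => f k) (f j)) →
      ∃ a, Q i (fun k _ => f k) a) :
    ∃ f : I → α, ∀ i, Q i (fun k _ => f k) (f i) := by
  classical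
  let f : I → α := WellFounded.fix (wellFounded_lt (α := I)) fun i ih =>
    Classical.epsilon (Q i ih)
  have hf : ∀ i, f i = Classical.epsilon (Q i fun k _ => f k) := fun i =>
    WellFounded.fix_eq _ _ i
  refine ⟨f, fun i => ?_⟩
  induction i using WellFoundedLT.induction with
  | ind i ih =>
    rw [hf]
    exact Classical.epsilon_spec (h i f ih)

/-- There is an uncountable well-order in which countable families are strictly bounded. -/
theorem exists_wellOrder_bounded :
    ∃ (I : Type u) (_ : LinearOrder I) (_ : WellFoundedLT I), Nonempty I ∧
      (∀ i : I, (Set.Iio i).Countable) ∧ ∀ s : ℕ → I, ∃ i, ∀ n, s n < i := by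
  have hc : ∀ i : (ℵ₁ : Cardinal.{u}).ord.ToType, (Set.Iio i).Countable := fun i => by
    have h := Cardinal.mk_Iio_lt i (by simp)
    rw [mk_ord_toType] at h
    exact le_aleph0_iff_set_countable.1 (Order.lt_succ_iff.1 (h.trans_eq succ_aleph0.symm))
  have hu : ¬ (Set.univ : Set (ℵ₁ : Cardinal.{u}).ord.ToType).Countable := fun h => by
    have := le_aleph0_iff_set_countable.2 h
    rw [mk_univ, mk_ord_toType] at this
    exact absurd this aleph0_lt_aleph_one.not_ge
  refine ⟨(ℵ₁ : Cardinal.{u}).ord.ToType, inferInstance, inferInstance, ?_, hc, fun s => ?_⟩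
  · by_contra h
    rw [not_nonempty_iff] at h
    exact hu (Set.to_countable _)
  · by_contra! h
    refine hu (((Set.countable_iUnion fun n => (hc (s n)).union
      (Set.countable_singleton (s n)))).mono fun i _ => ?_)
    obtain ⟨n, hn⟩ := h i
    exact Set.mem_iUnion.2 ⟨n, hn.lt_or_eq⟩

/-- A point outside a closed set of a compact Hausdorff space lies in a closed `Gδ` set missing the
closed set. -/
theorem exists_closed_isGδ_disjoint {X : Type u} [TopologicalSpace X] [CompactSpace X] [T2Space X]
    {K : Set X} (hK : IsClosed K) {x : X} (hx : x ∉ K) :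
    ∃ Z : Set X, IsClosed Z ∧ IsGδ Z ∧ x ∈ Z ∧ Disjoint Z K := by
  obtain ⟨f, hf0, hf1, -⟩ := exists_continuous_zero_one_of_isClosed
    (isClosed_singleton (x := x)) hK (Set.disjoint_singleton_left.2 hx)
  refine ⟨f ⁻¹' {0}, isClosed_singleton.preimage f.continuous, ?_, hf0 rfl, ?_⟩
  · exact (isClosed_singleton (x := (0 : ℝ))).isGδ.preimage f.continuous
  · refine Set.disjoint_left.2 fun y hy hyK => ?_
    have h1 := hf1 hyK
    have h0 : f y = 0 := hy
    rw [h0] at h1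
    exact zero_ne_one h1

/-- If closures in a nonempty compact Hausdorff space are detected through countable sets and
families of size at most the continuum, some nonempty closed `Gδ` set lies in the closure of a set
of size at most the continuum. -/
theorem exists_isGδ_subset_closure {X : Type u} [TopologicalSpace X] [CompactSpace X] [T2Space X]
    [Nonempty X] (E : X → Set X) (hE𝔠 : ∀ x, #(E x) ≤ 𝔠)
    (hE : ∀ (S : Set X) (x : X), x ∈ closure S →
      ∃ τ : ℕ → X, (∀ n, τ n ∈ S) ∧ x ∈ closure (⋃ n, E (τ n))) :
    ∃ H A : Set X, H.Nonempty ∧ IsClosed H ∧ IsGδ H ∧ #A ≤ 𝔠 ∧ H ⊆ closure A := by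
  classical
  by_contra hno
  obtain ⟨I, _, _, hI, hcount, hbdd⟩ := exists_wellOrder_bounded.{u}
  -- The closed Gδ sets decrease, and each misses the closure of the families of all earlier points.
  -- A stage where this fails would provide the set `H` sought.
  obtain ⟨f, hf⟩ := exists_wellFounded_choice (I := I) (α := X × Set X)
    (fun i ih a => a.1 ∈ a.2 ∧ IsClosed a.2 ∧ IsGδ a.2 ∧ (∀ j h, a.2 ⊆ (ih j h).2) ∧
      ∀ y ∈ a.2, y ∉ closure (⋃ j, ⋃ h, E (ih j h).1)) (fun i f hf => by
    let F : Set X := ⋂ j ∈ Set.Iio i, (f j).2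
    have hFc : IsClosed F := isClosed_biInter fun j hj => (hf j hj).2.1
    have hFG : IsGδ F := IsGδ.biInter (hcount i) fun j hj => (hf j hj).2.2.1
    have hFne : F.Nonempty := by
      by_cases hne : (Set.Iio i).Nonempty
      · have : Nonempty (Set.Iio i) := hne.to_subtype
        have := IsCompact.nonempty_iInter_of_directed_nonempty_isCompact_isClosed
          (fun j : Set.Iio i => (f j).2) (by
            intro j k
            rcases le_total j k with h | h
            · refine ⟨k, ?_, subset_rfl⟩
              rcases h.eq_or_lt with rfl | h
              · exact subset_rfl
              · exact (hf k k.2).2.2.2.1 j h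
            · refine ⟨j, subset_rfl, ?_⟩
              rcases h.eq_or_lt with rfl | h
              · exact subset_rfl
              · exact (hf j j.2).2.2.2.1 k h)
          (fun j => ⟨_, (hf j j.2).1⟩) (fun j => (hf j j.2).2.1.isCompact)
          (fun j => (hf j j.2).2.1)
        simpa [F, Set.biInter_eq_iInter] using this
      · have : Set.Iio i = ∅ := Set.not_nonempty_iff_eq_empty.1 hne
        simp [F, this]
    let A : Set X := ⋃ j ∈ Set.Iio i, E (f j).1
    have hA : #A ≤ 𝔠 := by
      refine (mk_biUnion_le _ _).trans ?_
      have h1 : #(Set.Iio i) ≤ 𝔠 :=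
        (le_aleph0_iff_set_countable.2 (hcount i)).trans aleph0_le_continuum
      have h2 : (⨆ j : Set.Iio i, #(E (f j).1)) ≤ 𝔠 := ciSup_le' fun j => hE𝔠 _
      exact (mul_le_mul' h1 h2).trans continuum_mul_self.le
    obtain ⟨y, hyF, hyA⟩ : ∃ y ∈ F, y ∉ closure A := by
      by_contra! h
      exact hno ⟨F, A, hFne, hFc, hFG, hA, h⟩
    obtain ⟨Z, hZc, hZG, hyZ, hZA⟩ := exists_closed_isGδ_disjoint isClosed_closure hyA
    refine ⟨(y, F ∩ Z), ⟨hyF, hyZ⟩, hFc.inter hZc, hFG.inter hZG, fun j h z hz => ?_,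
      fun z hz => ?_⟩
    · exact Set.mem_iInter₂.1 hz.1 j h
    · exact Set.disjoint_left.1 hZA hz.2)
  have hx : ∀ i j, i ≤ j → (f j).1 ∈ (f i).2 := fun i j hij => by
    rcases hij.eq_or_lt with rfl | h
    · exact (hf i).1
    · exact (hf j).2.2.2.1 i h (hf j).1
  -- `z` lies in every Gδ set of the sequence, yet is detected by countably many of its points, all
  -- before some stage `i`.
  obtain ⟨z, hz⟩ := IsCompact.nonempty_iInter_of_directed_nonempty_isCompact_isClosed
    (fun i : I => closure ((fun j => (f j).1) '' Set.Ici i)) (by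
      intro j k
      refine ⟨max j k, ?_, ?_⟩ <;>
        refine closure_mono (Set.image_mono (Set.Ici_subset_Ici.2 ?_)) <;> simp)
    (fun i => ⟨(f i).1, subset_closure ⟨i, le_refl i, rfl⟩⟩) (fun i => isClosed_closure.isCompact)
    (fun i => isClosed_closure)
  rw [Set.mem_iInter] at hz
  have hzF : ∀ i, z ∈ (f i).2 := fun i => by
    refine closure_minimal ?_ (hf i).2.1 (hz i)
    rintro _ ⟨j, hj, rfl⟩
    exact hx i j hj
  have hzr : z ∈ closure (Set.range fun j => (f j).1) :=
    closure_mono (Set.image_subset_range _ _) (hz (Classical.arbitrary I))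
  obtain ⟨τ, hτ, hzτ⟩ := hE _ z hzr
  choose j hj using hτ
  obtain ⟨i, hi⟩ := hbdd j
  refine (hf i).2.2.2.2 z (hzF i) (closure_mono ?_ hzτ)
  refine Set.iUnion_subset fun n => ?_
  rw [← hj n]
  exact fun y hy => Set.mem_iUnion₂.2 ⟨j n, hi n, hy⟩

/-- Under the detection hypothesis on closures, a nonempty compact Hausdorff space has a nonempty
`Gδ` subset each of whose points is separated from all other points of the space by members of a
fixed family of open sets of size at most the continuum. -/
theorem exists_isGδ_separating {X : Type u} [TopologicalSpace X] [CompactSpace X] [T2Space X]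
    [Nonempty X] {R : Type u} (hR : #R ≤ 𝔠) (E : X → R → ℕ → X)
    (hE : ∀ (S : Set X) (x : X), x ∈ closure S → ∃ (r : R) (τ : ℕ → X),
      (∀ n, τ n ∈ S) ∧ x ∈ closure (Set.range fun p : ℕ × ℕ => E (τ p.1) r p.2)) :
    ∃ (H : Set X) (V : Set (Set X)), H.Nonempty ∧ IsGδ H ∧ #V ≤ 𝔠 ∧ (∀ W ∈ V, IsOpen W) ∧
      ∀ a ∈ H, ∀ b, b ≠ a → ∃ W ∈ V, a ∈ W ∧ b ∉ W := by
  classical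
  have hE𝔠 : ∀ x, #(Set.range fun p : R × ℕ => E x p.1 p.2) ≤ 𝔠 := fun x =>
    mk_range_le_continuum _ (mk_prod_le_continuum hR (by simpa using aleph0_le_continuum))
  obtain ⟨H, A₀, hHne, hHc, hHG, hA₀, hHA₀⟩ :=
    exists_isGδ_subset_closure (fun x => Set.range fun p : R × ℕ => E x p.1 p.2) hE𝔠
    (fun S x hx => by
      obtain ⟨r, τ, hτ, hxτ⟩ := hE S x hx
      refine ⟨τ, hτ, closure_mono ?_ hxτ⟩
      rintro _ ⟨p, rfl⟩
      exact Set.mem_iUnion.2 ⟨p.1, (r, p.2), rfl⟩)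
  obtain ⟨A, hA₀A, hA, hAcl⟩ := exists_closed_under
    (fun σ => Set.range fun p : R × ℕ => E (σ 0) p.1 p.2) (fun σ => hE𝔠 (σ 0)) A₀ hA₀
  have hAE : ∀ d ∈ A, ∀ r k, E d r k ∈ A := fun d hd r k => hAcl (fun _ => d) (fun _ => hd)
    ⟨(r, k), rfl⟩
  obtain ⟨O, hO, hHO⟩ := isGδ_iff_eq_iInter_nat.1 hHG
  let c : (ℕ → A) → Set X := fun σ => (closure (Set.range fun n => (σ n : X)))ᶜ
  refine ⟨H, Set.range O ∪ Set.range c, hHne, hHG, ?_, ?_, ?_⟩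
  · refine (mk_union_le _ _).trans ?_
    refine (add_le_add (mk_range_le_continuum O ?_)
      (mk_range_le_continuum c (mk_seq_le_continuum hA))).trans continuum_add_self.le
    simpa using aleph0_le_continuum
  · rintro W (⟨n, rfl⟩ | ⟨σ, rfl⟩)
    · exact hO n
    · exact isClosed_closure.isOpen_compl
  · intro a ha b hba
    by_cases hb : b ∈ H
    · obtain ⟨Oa, Ob, hOa, hOb, haO, hbO, hdisj⟩ := t2_separation hba.symm
      obtain ⟨σ, hσ, hbσ⟩ := exists_seq_of_mem_closure hE hAE (closure_mono hA₀A (hHA₀ hb))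
      -- Cutting the sequence down to `Ob` keeps `b` in its closure and removes `a`.
      have hbQ : b ∈ closure (Ob ∩ Set.range σ) :=
        hOb.inter_closure ⟨hbO, hbσ⟩
      obtain ⟨τ, hτ⟩ := ((Set.countable_range σ).mono Set.inter_subset_right).exists_eq_range
        (closure_nonempty_iff.1 ⟨b, hbQ⟩)
      have hτA : ∀ n, τ n ∈ A := fun n => by
        have : τ n ∈ Ob ∩ Set.range σ := hτ ▸ ⟨n, rfl⟩
        obtain ⟨m, hm⟩ := this.2
        exact hm ▸ hσ m
      refine ⟨c fun n => ⟨τ n, hτA n⟩, Or.inr ⟨_, rfl⟩, ?_, ?_⟩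
      · change a ∉ closure (Set.range τ)
        rw [← hτ]
        intro h
        obtain ⟨y, hy1, hy2⟩ := mem_closure_iff.1 h Oa hOa haO
        exact Set.disjoint_left.1 hdisj hy1 hy2.1
      · change ¬ (b ∉ closure (Set.range τ))
        rw [← hτ]
        exact not_not.2 hbQ
    · rw [hHO, Set.mem_iInter] at ha hb
      push Not at hb
      obtain ⟨n, hn⟩ := hb
      exact ⟨O n, Or.inl ⟨n, rfl⟩, ha n, hn⟩

/-! ### Transfer to closures of countable sets by homogeneity. -/

/-- Continuum many members of a family of `Gδ` neighborhoods cover the closure of a countable set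
in a compact Hausdorff space. -/
theorem exists_isGδ_subcover {X : Type u} [TopologicalSpace X] [CompactSpace X] [T2Space X]
    (σ : ℕ → X) (K : X → Set X) (hK : ∀ y, IsGδ (K y)) (hmem : ∀ y, y ∈ K y) :
    ∃ Y : Set X, #Y ≤ 𝔠 ∧ ∀ y ∈ closure (Set.range σ), ∃ d ∈ Y, y ∈ K d := by
  classical
  choose O hO hKO using fun y => isGδ_iff_eq_iInter_nat.1 (hK y)
  have ht : ∀ y n, ∃ t ∈ 𝓝 y, IsClosed t ∧ t ⊆ O y n := fun y n =>
    exists_mem_nhds_isClosed_subset ((hO y n).mem_nhds (by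
      have := hmem y
      rw [hKO y] at this
      exact Set.mem_iInter.1 this n))
  choose t htn htc htO using ht
  -- Points are classified by the traces of their closed neighborhoods on `σ`; there are only `𝔠`
  -- traces, and one representative of each suffices.
  let β : X → ℕ → Set ℕ := fun y n => {k | σ k ∈ t y n}
  choose r hr using fun b : Set.range β => b.2
  refine ⟨Set.range r, mk_range_le_continuum _ ?_, fun y hy => ⟨_, ⟨⟨β y, y, rfl⟩, rfl⟩, ?_⟩⟩
  · exact (mk_set_le _).trans (mk_seq_le_continuum mk_set_nat.le)
  · have hd : β (r ⟨β y, y, rfl⟩) = β y := hr ⟨β y, y, rfl⟩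
    generalize r ⟨β y, y, rfl⟩ = d at hd
    rw [hKO, Set.mem_iInter]
    intro n
    refine htO _ n (closure_minimal (s := t y n ∩ Set.range σ) ?_ (htc _ n) ?_)
    · rintro _ ⟨hk, ⟨k, rfl⟩⟩
      have : k ∈ β d n := by rw [hd]; exact hk
      exact this
    · exact mem_closure_iff_nhds.2 fun U hU => by
        obtain ⟨z, hz, hzr⟩ := mem_closure_iff_nhds.1 hy _ (Filter.inter_mem hU (htn y n))
        exact ⟨z, hz.1, hz.2, hzr⟩

/-- In a homogeneous power of `X`, every point `d` of `X` is the value at a fixed constant function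
of a continuous open map to `X` that has a continuous section. -/
theorem exists_openMap_section {X : Type u} [TopologicalSpace X] {ι : Type v} [Nonempty ι]
    (hom : IsHomogeneousSpace (ι → X)) (p d : X) :
    ∃ (f : (ι → X) → X) (s : X → ι → X), Continuous f ∧ IsOpenMap f ∧ Continuous s ∧
      (∀ q, f (s q) = q) ∧ s d = fun _ => p := by
  classical
  obtain ⟨h, hh⟩ := hom (fun _ => p) (fun _ => d)
  let i₀ : ι := Classical.arbitrary ι
  refine ⟨fun z => h z i₀, fun q => h.symm (Function.update (fun _ => d) i₀ q),
    (continuous_apply i₀).comp h.continuous, (isOpenMap_eval i₀).comp h.isOpenMap,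
    h.symm.continuous.comp (continuous_const.update i₀ continuous_id), fun q => by simp, ?_⟩
  have : Function.update (fun _ : ι => d) i₀ d = fun _ => d := Function.update_eq_self _ _
  simp only [this]
  rw [← hh, h.symm_apply_apply]

/-- The closure of a countable set in a compact Hausdorff space of countable π-character with a
homogeneous power is separated from all points by a family of open sets of size at most the
continuum, as soon as this holds for one nonempty `Gδ` set. -/
theorem exists_separating_closure_range {X : Type u} [TopologicalSpace X] [CompactSpace X]
    [T2Space X] (hpi : HasCountablePiCharacter X) {ι : Type v} [Nonempty ι]
    (hom : IsHomogeneousSpace (ι → X)) {H : Set X} (hne : H.Nonempty) (hH : IsGδ H)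
    {V : Set (Set X)} (hV : #V ≤ 𝔠) (hVo : ∀ W ∈ V, IsOpen W)
    (hsep : ∀ a ∈ H, ∀ b, b ≠ a → ∃ W ∈ V, a ∈ W ∧ b ∉ W) (σ : ℕ → X) :
    ∃ VQ : Set (Set X), #VQ ≤ 𝔠 ∧ (∀ W ∈ VQ, IsOpen W) ∧
      ∀ y ∈ closure (Set.range σ), ∀ q, q ≠ y → ∃ W ∈ VQ, y ∈ W ∧ q ∉ W := by
  classical
  obtain ⟨p, hp⟩ := hne
  choose f s hf hfo hs hfs hsd using exists_openMap_section hom p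
  have hε : ∀ d, ∃ ε : ℕ → ι, ∀ y ∈ closure (Set.range σ), ∀ w : ι → X,
      (∀ n, w (ε n) = s d y (ε n)) → f d w = y := fun d => by
    choose e he using fun k => exists_seq_slice_const hpi (f d) (hf d) (hfo d) (s d (σ k))
    refine ⟨fun n => e n.unpair.1 n.unpair.2, fun y hy w hw => ?_⟩
    let N : Set ι := Set.range fun n : ℕ => e n.unpair.1 n.unpair.2
    -- Off `N` the section is frozen at `w`. Then `f d ∘ m` is the identity on the range of `σ`,
    -- hence on its closure.
    let m : X → ι → X := fun q i => if i ∈ N then s d q i else w i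
    have hm : Continuous m := continuous_pi fun i => by
      by_cases hi : i ∈ N
      · simpa [m, hi, Function.comp_def] using (continuous_apply i).comp (hs d)
      · simpa [m, hi] using continuous_const
    have hEq : Set.EqOn (fun q => f d (m q)) id (Set.range σ) := by
      rintro _ ⟨k, rfl⟩
      refine (he k (m (σ k)) fun n => ?_).trans (hfs d _)
      have : e k n ∈ N := ⟨Nat.pair k n, by simp⟩
      simp [m, this]
    have hmy : m y = w := by
      funext i
      by_cases hi : i ∈ N
      · obtain ⟨n, rfl⟩ := hi
        have : e n.unpair.1 n.unpair.2 ∈ N := ⟨n, rfl⟩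
        simp only [m, this, if_true]
        exact (hw n).symm
      · simp [m, hi]
    have := hEq.closure ((hf d).comp hm) continuous_id hy
    simpa [hmy] using this
  choose ε hε using hε
  obtain ⟨Y, hY, hYcov⟩ := exists_isGδ_subcover σ (fun d => {q | ∀ n, s d q (ε d n) ∈ H})
    (fun d => by
      have : {q | ∀ n, s d q (ε d n) ∈ H} = ⋂ n, (fun q => s d q (ε d n)) ⁻¹' H := by
        ext q; simp
      rw [this]
      exact IsGδ.iInter fun n => hH.preimage ((continuous_apply _).comp (hs d)))
    (fun d n => by rw [hsd]; exact hp)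
  refine ⟨Set.range fun x : Y × ℕ × V => (fun q => s x.1 q (ε x.1 x.2.1)) ⁻¹' x.2.2, ?_, ?_, ?_⟩
  · exact mk_range_le_continuum _ (mk_prod_le_continuum hY
      (mk_prod_le_continuum (by simpa using aleph0_le_continuum) hV))
  · rintro _ ⟨x, rfl⟩
    exact (hVo _ x.2.2.2).preimage ((continuous_apply _).comp (hs _))
  · intro y hy q hqy
    obtain ⟨d, hd, hyd⟩ := hYcov y hy
    obtain ⟨n, hn⟩ : ∃ n, s d q (ε d n) ≠ s d y (ε d n) := by
      by_contra! h
      exact hqy ((hfs d q).symm.trans (hε d y hy _ h))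
    obtain ⟨W, hW, h1, h2⟩ := hsep _ (hyd n) _ hn
    exact ⟨_, ⟨(⟨d, hd⟩, n, ⟨W, hW⟩), rfl⟩, h1, h2⟩

/-! ### A small dense set, and the final count. -/

/-- A compact space in which closures of countable sets are separated from all points by small
families of open sets, and closures are detected by countable sets, has a small dense subset. -/
theorem exists_dense_le_continuum {X : Type u} [TopologicalSpace X] [CompactSpace X]
    [Nonempty X] {R : Type u} (hR : #R ≤ 𝔠) (E : X → R → ℕ → X)
    (hE : ∀ (S : Set X) (x : X), x ∈ closure S → ∃ (r : R) (τ : ℕ → X),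
      (∀ n, τ n ∈ S) ∧ x ∈ closure (Set.range fun p : ℕ × ℕ => E (τ p.1) r p.2))
    (hsep : ∀ σ : ℕ → X, ∃ V : Set (Set X), #V ≤ 𝔠 ∧ (∀ W ∈ V, IsOpen W) ∧
      ∀ y ∈ closure (Set.range σ), ∀ q, q ≠ y → ∃ W ∈ V, y ∈ W ∧ q ∉ W) :
    ∃ D : Set X, Dense D ∧ #D ≤ 𝔠 := by
  classical
  choose V hV hVo hVs using hsep
  have hπ : ∀ t : ℕ → Set X, ∃ x, (∃ y, y ∉ ⋃ n, t n) → x ∉ ⋃ n, t n := fun t => by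
    by_cases h : ∃ y, y ∉ ⋃ n, t n
    · exact ⟨h.choose, fun _ => h.choose_spec⟩
    · exact ⟨Classical.arbitrary X, fun h' => absurd h' h⟩
  choose π hπ using hπ
  -- Pairing packs countably many sequences into one, so that a single closing-off step sees the
  -- open sets attached to all of them.
  let 𝒱 : (ℕ → X) → Set (Set X) := fun σ => ⋃ k, V fun j => σ (Nat.pair k j)
  have h𝒱 : ∀ σ, #(𝒱 σ) ≤ 𝔠 := fun σ => by
    have h1 := mk_iUnion_le_lift (fun k => V fun j => σ (Nat.pair k j))
    have h2 : (⨆ k, #(V fun j => σ (Nat.pair k j))) ≤ 𝔠 := ciSup_le' fun k => hV _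
    rw [lift_uzero, mk_nat, lift_aleph0] at h1
    refine h1.trans ((mul_le_mul' aleph0_le_continuum ?_).trans continuum_mul_self.le)
    simpa using h2
  obtain ⟨D, hD₀, hD, hDcl⟩ := exists_closed_under
    (fun σ => (Set.range fun x : R × ℕ => E (σ 0) x.1 x.2) ∪
      Set.range fun t : ℕ → 𝒱 σ => π fun n => t n)
    (fun σ => (mk_union_le _ _).trans ((add_le_add
      (mk_range_le_continuum _ (mk_prod_le_continuum hR (by simpa using aleph0_le_continuum)))
      (mk_range_le_continuum _ (mk_seq_le_continuum (h𝒱 σ)))).trans continuum_add_self.le))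
    {Classical.arbitrary X} (by simpa using one_le_aleph0.trans aleph0_le_continuum)
  have hDE : ∀ d ∈ D, ∀ r k, E d r k ∈ D := fun d hd r k => hDcl (fun _ => d) (fun _ => hd)
    (Or.inl ⟨(r, k), rfl⟩)
  refine ⟨D, fun q => ?_, hD⟩
  by_contra hq
  choose σ hσ hxσ using fun x : closure D => exists_seq_of_mem_closure hE hDE x.2
  choose W hWV hxW hqW using fun x : closure D =>
    hVs (σ x) x (hxσ x) q fun h => hq (h ▸ x.2)
  obtain ⟨F, hF⟩ := (isClosed_closure (s := D)).isCompact.elim_finite_subcover W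
    (fun x => hVo _ _ (hWV x)) fun x hx => Set.mem_iUnion.2 ⟨⟨x, hx⟩, hxW ⟨x, hx⟩⟩
  have hFne : (F : Set (closure D)).Nonempty := by
    have := hF (subset_closure (hD₀ rfl))
    obtain ⟨x, hx, -⟩ := Set.mem_iUnion₂.1 this
    exact ⟨x, hx⟩
  obtain ⟨y, hy⟩ := F.countable_toSet.exists_eq_range hFne
  let τ : ℕ → X := fun n => σ (y n.unpair.1) n.unpair.2
  have hτ : ∀ k, W (y k) ∈ 𝒱 τ := fun k => Set.mem_iUnion.2 ⟨k, by
    simpa [τ] using hWV (y k)⟩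
  have hmem : (π fun n => W (y n)) ∈ D := hDcl τ (fun n => hσ _ _)
    (Or.inr ⟨fun n => ⟨W (y n), hτ n⟩, rfl⟩)
  refine hπ (fun n => W (y n)) ⟨q, by simpa using fun n => hqW (y n)⟩ ?_
  obtain ⟨x, hx, hxm⟩ := Set.mem_iUnion₂.1 (hF (subset_closure hmem))
  have : x ∈ Set.range y := hy ▸ hx
  obtain ⟨n, rfl⟩ := this
  exact Set.mem_iUnion.2 ⟨n, hxm⟩

/-- A compact Hausdorff space of countable π-character with a homogeneous power has size at most the
continuum if it has a dense subset of size at most the continuum. -/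
theorem mk_le_continuum_of_dense {X : Type u} [TopologicalSpace X] [CompactSpace X]
    [T2Space X] [Nonempty X] (hpi : HasCountablePiCharacter X) {ι : Type v} [Nonempty ι]
    (hom : IsHomogeneousSpace (ι → X)) {D : Set X} (hD : Dense D) (hD𝔠 : #D ≤ 𝔠) : #X ≤ 𝔠 := by
  classical
  let p : X := Classical.arbitrary X
  choose f s hf hfo hs hfs hsd using exists_openMap_section hom p
  choose e he using fun x => exists_seq_slice_const hpi (f x) (hf x) (hfo x) fun _ => p
  obtain ⟨U, hU, hUsub⟩ := exists_seq_localPiBase hpi p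
  have htube : ∀ (x : X) (O : Set X), IsOpen O → x ∈ O → ∃ n : ℕ, ∃ W ∈ 𝓝 p, ∀ z : ι → X,
      (∀ k < n, z (e x k) ∈ W) → f x z ∈ O := fun x O hO hx => by
    -- A tube argument: the slice through the constant function `p` maps to `x`, and compactness
    -- thickens it to finitely many coordinates.
    have hρ : Continuous fun (z : ι → X) (k : ℕ) => z (e x k) :=
      continuous_pi fun k => continuous_apply _
    have hcl : IsClosed ((fun (z : ι → X) (k : ℕ) => z (e x k)) '' (f x ⁻¹' O)ᶜ) :=
      ((hO.preimage (hf x)).isClosed_compl.isCompact.image hρ).isClosed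
    obtain ⟨I, t, ht, hI⟩ := exists_finset_box hcl.isOpen_compl (w := fun _ => p) (by
      rintro ⟨z, hz, hzp⟩
      refine hz ?_
      have h1 := he x z fun n => congrFun hzp n
      have h2 : f x z = x := by rw [h1, ← hsd x, hfs]
      change f x z ∈ O
      rwa [h2])
    refine ⟨I.sup id + 1, ⋂ i ∈ I, t i,
      (Filter.biInter_finset_mem I).2 fun i _ => (ht i).1.mem_nhds (ht i).2, fun z hz => ?_⟩
    by_contra hno
    refine hI (fun k => z (e x k)) (fun i hi => ?_) ⟨z, hno, rfl⟩
    exact Set.mem_iInter₂.1 (hz i (Nat.lt_succ_of_le (Finset.le_sup (f := id) hi))) i hi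
  -- The index `k` codes a pair: how many coordinates to restrict, and which π-base set at `p` to
  -- use.
  have hφ : ∀ (x : X) (k : ℕ), ∃ d : D, ∃ z : ι → X,
      (∀ j < k.unpair.1, z (e x j) ∈ U k.unpair.2) ∧ f x z = d := fun x k => by
    let P : Set (ι → X) := ⋂ j ∈ Finset.range k.unpair.1, (fun z => z (e x j)) ⁻¹' U k.unpair.2
    have hP : IsOpen P := isOpen_biInter_finset fun j _ =>
      (hU _).1.preimage (continuous_apply _)
    obtain ⟨y, hy⟩ := (hU k.unpair.2).2
    have hPne : P.Nonempty := ⟨fun _ => y, by simp [P, hy]⟩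
    obtain ⟨_, ⟨z, hz, rfl⟩, hd⟩ := hD.inter_open_nonempty _ (hfo x P hP) (hPne.image _)
    exact ⟨⟨_, hd⟩, z, fun j hj => Set.mem_iInter₂.1 hz j (Finset.mem_range.2 hj), rfl⟩
  choose φ hφ using hφ
  refine (mk_le_of_injective (f := φ) fun x y hxy => ?_).trans (mk_seq_le_continuum hD𝔠)
  by_contra hne
  obtain ⟨O1, O2, hO1, hO2, hx, hy, hdisj⟩ := t2_separation hne
  obtain ⟨n1, W1, hW1, h1⟩ := htube x O1 hO1 hx
  obtain ⟨n2, W2, hW2, h2⟩ := htube y O2 hO2 hy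
  obtain ⟨m, hm⟩ := hUsub _ (Filter.inter_mem hW1 hW2)
  have key : ∀ (x : X) (n : ℕ) (O W : Set X), n ≤ max n1 n2 → U m ⊆ W →
      (∀ z : ι → X, (∀ k < n, z (e x k) ∈ W) → f x z ∈ O) →
      (φ x (Nat.pair (max n1 n2) m) : X) ∈ O := fun x n O W hn hmW h => by
    obtain ⟨z, hz, hzd⟩ := hφ x (Nat.pair (max n1 n2) m)
    rw [← hzd]
    exact h z fun k hk => hmW (by simpa using hz k (by simpa using hk.trans_le hn))
  have k1 := key x n1 O1 W1 (le_max_left _ _) (hm.trans Set.inter_subset_left) h1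
  have k2 := key y n2 O2 W2 (le_max_right _ _) (hm.trans Set.inter_subset_right) h2
  rw [hxy] at k1
  exact Set.disjoint_left.1 hdisj k1 k2

/-- A power homogeneous compactum of countable π-character that is covered by at most continuum many
dense, countably tight subspaces has cardinality at most the continuum. -/
theorem corollary3p9 (X : Type u) [TopologicalSpace X] [CompactSpace X] [T2Space X]
    (hpow : IsPowerHomogeneous.{u, v} X) (hpi : HasCountablePiCharacter X)
    (𝒞 : Set (Set X)) (hcover : ⋃₀ 𝒞 = Set.univ) (hcard : #𝒞 ≤ 𝔠)
    (hC : ∀ C ∈ 𝒞, Dense C ∧ IsCountablyTight C) :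
    #X ≤ 𝔠 := by
  rcases isEmpty_or_nonempty X with hX | hX
  · simp
  obtain ⟨ι, hι, hom⟩ := hpow
  obtain ⟨E, hE⟩ := exists_tightness_witness hpi 𝒞 hcover hC
  obtain ⟨H, V, hne, hH, hV, hVo, hsep⟩ := exists_isGδ_separating hcard E hE
  obtain ⟨D, hD, hD𝔠⟩ := exists_dense_le_continuum hcard E hE
    (exists_separating_closure_range hpi hom hne hH hV hVo hsep)
  exact mk_le_continuum_of_dense hpi hom hD hD𝔠
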